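/- Let $d\ge 0$ be an integer and, for each $n\in\mathbb Z$, let $V_n:\mathbb R^d\to\mathbb R$ be a $C^2$ function that is $\mathbb Z^d$-periodic, i.e. $V_n(q+e)=V_n(q)$ for all $q\in\mathbb R^d$, $e\in\mathbb Z^d$. Put $S_n(q,Q)=\tfrac12\|Q-q\|^2+V_n(q)$ for $q,Q\in\mathbb R^d$, and consider the Frenkel–Kontorova functional, the formal sum $F(\{q_n\})=\sum_{n\in\mathbb Z}S_n(q_n,q_{n+1})$ on sequences $\{q_n\}_{n\in\mathbb Z}$ in $\mathbb R^d$. An extremal of $F$ is a sequence with $$\partial_2S_{n-1}(q_{n-1},q_n)+\partial_1S_n(q_n,q_{n+1})=0\quad\text{for all }n\in\mathbb Z,$$ where $\partial_1,\partial_2$ denote the gradients in the first and second vector variable. A Jacobi field along $\{q_n\}$ is a sequence $\{\xi_n\}_{n\in\mathbb Z}$ in $\mathbb R^d$ with $$b_{n-1}^T\xi_{n-1}+a_n\xi_n+b_n\xi_{n+1}=0\quad\text{for all }n\in\mathbb Z,$$ where $b_n=\partial_{12}S_n(q_n,q_{n+1})$ and $a_n=\partial_{11}S_n(q_n,q_{n+1})+\partial_{22}S_{n-1}(q_{n-1},q_n)$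 are matrices of second derivatives. An extremal has conjugate points if there are $m\ne n$ in $\mathbb Z$ and a Jacobi field along it, not identically zero, with $\xi_m=\xi_n=0$. Suppose that the sequence $(V_n)_{n\in\mathbb Z}$ is either periodic in $n$ (there is an integer $p>0$ with $V_{n+p}=V_n$ for all $n$), or such that $V_n$ is a constant function for all but finitely many $n$. Then either some extremal of $F$ has conjugate points, or every $V_n$ is a constant function. -/

import Mathlib

namespace DiscreteVariational

/-- The Euclidean space `ℝ^d`. -/
abbrev E (d : ℕ) : Type := EuclideanSpace ℝ (Fin d)

/-- An integer vector `e ∈ ℤ^d`, seen as a vector of `ℝ^d`. -/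
def latticeVector {d : ℕ} (e : Fin d → ℤ) : E d := WithLp.toLp 2 (fun i => (e i : ℝ))

/-- `ℤ^d`-periodicity of a function on `ℝ^d`. -/
def IsLatticePeriodic {d : ℕ} (V : E d → ℝ) : Prop :=
  ∀ e : Fin d → ℤ, Function.Periodic V (latticeVector e)

/-- The function `V` is constant. -/
def IsConstant {d : ℕ} (V : E d → ℝ) : Prop := ∃ c : ℝ, ∀ q : E d, V q = c

section Derivatives

variable {d : ℕ}

/-- `∂₁S(q, Q)`: the gradient of `S(·, Q)` at `q`. -/
noncomputable def partial1 (S : E d → E d → ℝ) (q Q : E d) : E d :=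
  gradient (fun u => S u Q) q

/-- `∂₂S(q, Q)`: the gradient of `S(q, ·)` at `Q`. -/
noncomputable def partial2 (S : E d → E d → ℝ) (q Q : E d) : E d :=
  gradient (fun U => S q U) Q

/-- `∂₁₁S(q, Q)`, the matrix `(∂²S / ∂qᵢ∂qⱼ)` as a linear map. -/
noncomputable def partial11 (S : E d → E d → ℝ) (q Q : E d) : E d →L[ℝ] E d :=
  fderiv ℝ (fun u => partial1 S u Q) q

/-- `∂₁₂S(q, Q)`, the matrix `(∂²S / ∂qᵢ∂Qⱼ)` (row `i`, column `j`) as a linear map. -/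
noncomputable def partial12 (S : E d → E d → ℝ) (q Q : E d) : E d →L[ℝ] E d :=
  fderiv ℝ (fun U => partial1 S q U) Q

/-- `∂₂₂S(q, Q)`, the matrix `(∂²S / ∂Qᵢ∂Qⱼ)` as a linear map. -/
noncomputable def partial22 (S : E d → E d → ℝ) (q Q : E d) : E d →L[ℝ] E d :=
  fderiv ℝ (fun U => partial2 S q U) Q

end Derivatives

section Extremals

variable {d : ℕ}

/-- The bi-infinite configuration `q` is an extremal of the formal sum
`F({qₙ}) = ∑ₙ Sₙ(qₙ, qₙ₊₁)`. -/
def IsExtremal (S : ℤ → E d → E d → ℝ) (q : ℤ → E d) : Prop :=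
  ∀ n : ℤ, partial2 (S (n - 1)) (q (n - 1)) (q n) + partial1 (S n) (q n) (q (n + 1)) = 0

/-- `aₙ = ∂₁₁Sₙ(qₙ, qₙ₊₁) + ∂₂₂Sₙ₋₁(qₙ₋₁, qₙ)`. -/
noncomputable def jacobiA (S : ℤ → E d → E d → ℝ) (q : ℤ → E d) (n : ℤ) : E d →L[ℝ] E d :=
  partial11 (S n) (q n) (q (n + 1)) + partial22 (S (n - 1)) (q (n - 1)) (q n)

/-- `bₙ = ∂₁₂Sₙ(qₙ, qₙ₊₁)`. -/
noncomputable def jacobiB (S : ℤ → E d → E d → ℝ) (q : ℤ → E d) (n : ℤ) : E d →L[ℝ] E d :=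
  partial12 (S n) (q n) (q (n + 1))

/-- `ξ` is a Jacobi field along `q`: `bₙ₋₁ᵀ ξₙ₋₁ + aₙ ξₙ + bₙ ξₙ₊₁ = 0` for all `n`. -/
def IsJacobiField (S : ℤ → E d → E d → ℝ) (q ξ : ℤ → E d) : Prop :=
  ∀ n : ℤ, ContinuousLinearMap.adjoint (jacobiB S q (n - 1)) (ξ (n - 1))
    + jacobiA S q n (ξ n) + jacobiB S q n (ξ (n + 1)) = 0

/-- The points with (different) indices `m` and `n` of the configuration `q` are conjugate:
some Jacobi field along `q`, not identically zero, vanishes at both. -/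
def AreConjugate (S : ℤ → E d → E d → ℝ) (q : ℤ → E d) (m n : ℤ) : Prop :=
  m ≠ n ∧ ∃ ξ : ℤ → E d, IsJacobiField S q ξ ∧ (∃ k : ℤ, ξ k ≠ 0) ∧ ξ m = 0 ∧ ξ n = 0

/-- The configuration `q` has a pair of conjugate points. -/
def HasConjugatePoints (S : ℤ → E d → E d → ℝ) (q : ℤ → E d) : Prop :=
  ∃ m n : ℤ, AreConjugate S q m n

end Extremals

/-- The Frenkel–Kontorova generating functions `Sₙ(q, Q) = ½‖Q - q‖² + Vₙ(q)`. -/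
noncomputable def frenkelKontorova {d : ℕ} (V : ℤ → E d → ℝ) (n : ℤ) (q Q : E d) : ℝ :=
  1 / 2 * ‖Q - q‖ ^ 2 + V n q

end DiscreteVariational

/-!
Write `hess f q` for the Hessian of `f`. Extremals are the solutions of the recurrence
`qₙ₊₁ = 2 qₙ + ∇Vₙ(qₙ) - qₙ₋₁`, and Jacobi fields are the solutions of its linearization. Suppose
that no extremal has conjugate points. It is shown that then every Hessian `hess (V k) q` vanishes;
a periodic function with zero Hessian is constant (`isConstant_of_hess_eq_zero`).

*Positivity.* The second variation of the action on a segment with fixed endpoints is the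
`indexForm` `∑ ‖Δξ‖² + ⟨hess Vₙ(qₙ) ξₙ, ξₙ⟩`. By summation by parts its kernel consists of Jacobi
fields that vanish at both ends, so it is nondegenerate on every extremal. Extremals are
parametrized by two consecutive positions, hence by a connected space, so the form has the same
signature on all of them; it is nonnegative on the extremal through a minimizer of the action.
Hence it is nonnegative on all extremals (`indexForm_nonneg`).

*Averaging.* The dynamics on pairs of consecutive positions commutes with integer translations, up
to an automorphism of the lattice, and preserves Lebesgue measure on the torus of dimension `2d`
(`integral_orbitState`). Evaluate the form, along the orbit of each `x` in this torus, on the field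
equal to a basis vector `e` times a slowly varying cutoff, corrected by `-ε hess Vₖ(qₖ) e` at the
single time `k`, and integrate over `x`. The terms linear in the Hessians average to zero
(`integral_hess_stdBasis`), and what remains is
`0 ≤ O(1 / M) - 2 ε ∫ ‖hess (V k) e‖² + O(ε²)`, where the constants do not depend on the length
`M` of the ramps of the cutoff. Letting `M → ∞` and then `ε → 0` gives `∫ ‖hess (V k) e‖² = 0`.
-/

namespace DiscreteVariational

open InnerProductSpace MeasureTheory Filter Topology
open scoped RealInnerProductSpace

variable {d : ℕ}

/-! ### Hessians -/

/-- The Hessian of `f` at `q`, as the linear map `u ↦ ∂ᵤ∇f(q)`. -/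
noncomputable def hess (f : E d → ℝ) (q : E d) : E d →L[ℝ] E d := fderiv ℝ (gradient f) q

theorem contDiff_gradient {f : E d → ℝ} (hf : ContDiff ℝ 2 f) : ContDiff ℝ 1 (gradient f) :=
  (toDual ℝ (E d)).symm.toContinuousLinearEquiv.contDiff.comp
    (hf.fderiv_right (m := 1) (by norm_num))

theorem hasFDerivAt_gradient {f : E d → ℝ} (hf : ContDiff ℝ 2 f) (q : E d) :
    HasFDerivAt (gradient f) (hess f q) q :=
  ((contDiff_gradient hf).differentiable one_ne_zero q).hasFDerivAt

theorem continuous_hess {f : E d → ℝ} (hf : ContDiff ℝ 2 f) : Continuous (hess f) :=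
  (contDiff_gradient hf).continuous_fderiv one_ne_zero

theorem inner_hess_comm {f : E d → ℝ} (hf : ContDiff ℝ 2 f) (q u v : E d) :
    ⟪hess f q u, v⟫ = ⟪hess f q v, u⟫ := by
  have key : ∀ u v, ⟪hess f q u, v⟫ = fderiv ℝ (fderiv ℝ f) q u v := by
    intro u v
    have h1 : DifferentiableAt ℝ (fderiv ℝ f) q :=
      (hf.fderiv_right (m := 1) (by norm_num)).differentiable one_ne_zero q
    have h2 := (hasFDerivAt_gradient hf q).inner ℝ (hasFDerivAt_const v q)
    have h3 := h1.hasFDerivAt.clm_apply (hasFDerivAt_const v q)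
    have h4 : (fun x => ⟪gradient f x, v⟫) = fun x => fderiv ℝ f x v :=
      funext fun x => toDual_symm_apply
    rw [h4] at h2
    simpa using congrArg (· u) (h2.unique h3)
  rw [key, key]
  exact (hf.contDiffAt.isSymmSndFDerivAt (by simp)).eq u v

theorem gradient_add_latticeVector {f : E d → ℝ} (hf : IsLatticePeriodic f) (e : Fin d → ℤ)
    (q : E d) : gradient f (q + latticeVector e) = gradient f q := by
  have h : (fun x => f (x + latticeVector e)) = f := funext (hf e)
  rw [gradient, gradient, ← fderiv_comp_add_right, h]

theorem hess_add_latticeVector {f : E d → ℝ} (hf : IsLatticePeriodic f) (e : Fin d → ℤ)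
    (q : E d) : hess f (q + latticeVector e) = hess f q := by
  have h : (fun x => gradient f (x + latticeVector e)) = gradient f :=
    funext (gradient_add_latticeVector hf e)
  rw [hess, hess, ← fderiv_comp_add_right, h]

/-! ### The Euler–Lagrange and Jacobi equations -/

theorem hasGradientAt_half_norm_sub_sq (Q q : E d) :
    HasGradientAt (fun u : E d => 1 / 2 * ‖u - Q‖ ^ 2) (q - Q) q := by
  rw [hasGradientAt_iff_hasFDerivAt]
  have h := (((hasFDerivAt_id (𝕜 := ℝ) q).sub_const Q).norm_sq).const_mul (1 / 2 : ℝ)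
  refine h.congr_fderiv ?_
  ext v
  simp

theorem partial1_frenkelKontorova {V : ℤ → E d → ℝ} (hV : ∀ n, ContDiff ℝ 2 (V n)) (n : ℤ)
    (q Q : E d) : partial1 (frenkelKontorova V n) q Q = q - Q + gradient (V n) q := by
  have h1 : HasGradientAt (fun u => frenkelKontorova V n u Q)
      (q - Q + gradient (V n) q) q := by
    have h2 := (((hV n).differentiable two_ne_zero) q).hasGradientAt
    have h3 := hasGradientAt_half_norm_sub_sq Q q
    rw [hasGradientAt_iff_hasFDerivAt] at h2 h3 ⊢
    have := h3.add h2
    rw [map_add]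
    refine this.congr_of_eventuallyEq (Filter.Eventually.of_forall fun u => ?_)
    simp [frenkelKontorova, norm_sub_rev]
  exact h1.gradient

theorem partial2_frenkelKontorova (V : ℤ → E d → ℝ) (n : ℤ) (q Q : E d) :
    partial2 (frenkelKontorova V n) q Q = Q - q := by
  have h1 : HasGradientAt (fun U => frenkelKontorova V n q U) (Q - q) Q := by
    have h3 := hasGradientAt_half_norm_sub_sq q Q
    rw [hasGradientAt_iff_hasFDerivAt] at h3 ⊢
    exact h3.add_const (V n q)
  exact h1.gradient

theorem isExtremal_iff {V : ℤ → E d → ℝ} (hV : ∀ n, ContDiff ℝ 2 (V n)) (q : ℤ → E d) :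
    IsExtremal (frenkelKontorova V) q ↔
      ∀ n, q (n + 1) = (2 : ℝ) • q n + gradient (V n) (q n) - q (n - 1) := by
  refine forall_congr' fun n => ?_
  rw [partial1_frenkelKontorova hV, partial2_frenkelKontorova, ← sub_eq_zero (a := q (n + 1)),
    ← neg_eq_zero, two_smul]
  refine iff_of_eq (congrArg (· = 0) ?_)
  abel

theorem jacobiB_frenkelKontorova {V : ℤ → E d → ℝ} (hV : ∀ n, ContDiff ℝ 2 (V n)) (q : ℤ → E d)
    (n : ℤ) : jacobiB (frenkelKontorova V) q n = -ContinuousLinearMap.id ℝ (E d) := by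
  rw [jacobiB, partial12]
  simp only [partial1_frenkelKontorova hV]
  exact (((hasFDerivAt_id (𝕜 := ℝ) _).const_sub (q n)).add_const _).fderiv

theorem jacobiA_frenkelKontorova {V : ℤ → E d → ℝ} (hV : ∀ n, ContDiff ℝ 2 (V n)) (q : ℤ → E d)
    (n : ℤ) : jacobiA (frenkelKontorova V) q n =
      ContinuousLinearMap.id ℝ (E d) + hess (V n) (q n) + ContinuousLinearMap.id ℝ (E d) := by
  rw [jacobiA, partial11, partial22]
  simp only [partial1_frenkelKontorova hV, partial2_frenkelKontorova]
  congr 1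
  · exact (((hasFDerivAt_id (𝕜 := ℝ) _).sub_const _).add (hasFDerivAt_gradient (hV n) _)).fderiv
  · exact ((hasFDerivAt_id (𝕜 := ℝ) _).sub_const _).fderiv

theorem isJacobiField_iff {V : ℤ → E d → ℝ} (hV : ∀ n, ContDiff ℝ 2 (V n)) (q ξ : ℤ → E d) :
    IsJacobiField (frenkelKontorova V) q ξ ↔
      ∀ n, ξ (n + 1) = (2 : ℝ) • ξ n + hess (V n) (q n) (ξ n) - ξ (n - 1) := by
  refine forall_congr' fun n => ?_
  have hadj : ContinuousLinearMap.adjoint (-ContinuousLinearMap.id ℝ (E d)) =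
      -ContinuousLinearMap.id ℝ (E d) := by
    rw [map_neg]; congr 1; exact ContinuousLinearMap.adjoint_id
  rw [jacobiB_frenkelKontorova hV, jacobiB_frenkelKontorova hV, jacobiA_frenkelKontorova hV, hadj,
    ← sub_eq_zero (a := ξ (n + 1)), ← neg_eq_zero, two_smul]
  refine iff_of_eq (congrArg (· = 0) ?_)
  simp only [neg_apply, add_apply,
    ContinuousLinearMap.id_apply]
  abel

/-- A one-sided solution of a second-order recurrence that is solvable in both directions of time
extends to a two-sided solution. -/
theorem exists_recurrence_extension {A : Type*} [AddCommGroup A] (f : ℤ → A → A) (m : ℤ)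
    (a : ℕ → A) (ha : ∀ j : ℕ, a (j + 2) = f (m + j + 1) (a (j + 1)) - a j) :
    ∃ y : ℤ → A, (∀ j : ℕ, y (m + j) = a j) ∧ ∀ n, y (n + 1) = f n (y n) - y (n - 1) := by
  -- `b k` is the pair of values at the times `m - k` and `m - k + 1`
  let b : ℕ → A × A := fun k =>
    Nat.rec (a 0, a 1) (fun k p => (f (m - k) p.1 - p.2, p.1)) k
  have hb : ∀ k : ℕ, b (k + 1) = (f (m - k) (b k).1 - (b k).2, (b k).1) := fun k => rfl
  let y : ℤ → A := fun n => if m ≤ n then a (n - m).toNat else (b (m - n).toNat).1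
  have hy1 : ∀ j : ℕ, y (m + j) = a j := fun j => by simp [y]
  have hy2 : ∀ k : ℕ, y (m - k) = (b k).1 := by
    intro k
    rcases Nat.eq_zero_or_pos k with rfl | hk
    · simp [y, b]
    · have : ¬ m ≤ m - k := by omega
      simp [y, this]
  refine ⟨y, hy1, fun n => ?_⟩
  rcases lt_trichotomy n m with h | rfl | h
  · obtain ⟨k, rfl⟩ : ∃ k : ℕ, n = m - (k + 1 : ℕ) := ⟨(m - n - 1).toNat, by omega⟩
    have e1 : m - (k + 1 : ℕ) + 1 = m - k := by push_cast; ring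
    have e2 : m - (k + 1 : ℕ) - 1 = m - (k + 2 : ℕ) := by push_cast; ring
    rw [e1, e2, hy2, hy2, hy2, hb (k + 1)]
    simp only [hb k, sub_sub_cancel]
  · have h0 := hy1 0
    have h1 := hy1 1
    have h2 := hy2 1
    rw [show b 1 = _ from hb 0] at h2
    simp only [Nat.cast_zero, add_zero, Nat.cast_one, sub_zero] at h0 h1 h2
    rw [h0, h1, h2]
    simp [b]
  · obtain ⟨j, rfl⟩ : ∃ j : ℕ, n = m + j + 1 := ⟨(n - m - 1).toNat, by omega⟩
    have e1 : m + (j : ℤ) + 1 + 1 = m + (j + 2 : ℕ) := by push_cast; ring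
    have e2 : m + (j : ℤ) + 1 = m + (j + 1 : ℕ) := by push_cast; ring
    have e3 : m + (j : ℤ) + 1 - 1 = m + j := by ring
    rw [e1, e3, hy1, ha, e2, hy1, hy1]

/-! ### Summation by parts and the index form -/

/-- The index form `∑ ⟨Δξ, Δη⟩ + ⟨Wξ, η⟩` over the times `0, …, n + 1`; for `W` the Hessians along
an orbit this is the second variation of the action with both endpoints fixed. -/
noncomputable def indexForm (W : ℕ → E d →L[ℝ] E d) (n : ℕ) (ξ η : ℕ → E d) : ℝ :=
  ∑ j ∈ Finset.range (n + 1), (⟪ξ (j + 1) - ξ j, η (j + 1) - η j⟫ + ⟪W j (ξ j), η j⟫)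

theorem sum_inner_diff (ξ η : ℕ → E d) (n : ℕ) (h0 : η 0 = 0) :
    ∑ j ∈ Finset.range (n + 1), ⟪ξ (j + 1) - ξ j, η (j + 1) - η j⟫ =
      (∑ i ∈ Finset.range n, ⟪(2 : ℝ) • ξ (i + 1) - ξ i - ξ (i + 2), η (i + 1)⟫)
        + ⟪ξ (n + 1) - ξ n, η (n + 1)⟫ := by
  induction n with
  | zero => simp [h0]
  | succ n ih =>
    rw [Finset.sum_range_succ, ih, Finset.sum_range_succ]
    simp only [inner_sub_left, inner_sub_right, real_inner_smul_left]
    ring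

theorem sum_inner_shift (w η : ℕ → E d) (n : ℕ) (h0 : η 0 = 0) :
    ∑ j ∈ Finset.range (n + 1), ⟪w j, η j⟫ = ∑ i ∈ Finset.range n, ⟪w (i + 1), η (i + 1)⟫ := by
  rw [Finset.sum_range_succ', h0, inner_zero_right, add_zero]

/-- Summation by parts turns the index form into a pairing with the Jacobi operator. -/
theorem indexForm_eq_sum (W : ℕ → E d →L[ℝ] E d) (n : ℕ) (ξ η : ℕ → E d) (h0 : η 0 = 0)
    (hn : η (n + 1) = 0) :
    indexForm W n ξ η = ∑ i ∈ Finset.range n,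
      ⟪(2 : ℝ) • ξ (i + 1) - ξ i - ξ (i + 2) + W (i + 1) (ξ (i + 1)), η (i + 1)⟫ := by
  rw [indexForm, Finset.sum_add_distrib, sum_inner_diff ξ η n h0, hn, inner_zero_right, add_zero,
    sum_inner_shift (fun j => W j (ξ j)) η n h0, ← Finset.sum_add_distrib]
  simp only [inner_add_left]

theorem indexForm_add_smul_self (W : ℕ → E d →L[ℝ] E d) (hW : ∀ j u v, ⟪W j u, v⟫ = ⟪W j v, u⟫)
    (n : ℕ) (ξ η : ℕ → E d) (t : ℝ) :
    indexForm W n (ξ + t • η) (ξ + t • η) =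
      indexForm W n ξ ξ + 2 * t * indexForm W n ξ η + t ^ 2 * indexForm W n η η := by
  simp only [indexForm, Finset.mul_sum, ← Finset.sum_add_distrib]
  refine Finset.sum_congr rfl fun j _ => ?_
  have h1 := hW j (ξ j) (η j)
  have h2 := real_inner_comm (ξ (j + 1)) (η (j + 1))
  have h3 := real_inner_comm (ξ (j + 1)) (η j)
  have h4 := real_inner_comm (ξ j) (η (j + 1))
  have h5 := real_inner_comm (ξ j) (η j)
  simp only [Pi.add_apply, Pi.smul_apply, inner_add_left, inner_add_right, inner_sub_left,
    inner_sub_right, real_inner_smul_left, real_inner_smul_right, map_add, map_smul]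
  rw [← h1, h2, h3, h4, h5]
  ring

/-- A vector on which a nonnegative symmetric index form vanishes lies in its kernel. -/
theorem indexForm_eq_zero_of_nonneg (W : ℕ → E d →L[ℝ] E d)
    (hW : ∀ j u v, ⟪W j u, v⟫ = ⟪W j v, u⟫) (n : ℕ) (ξ η : ℕ → E d)
    (hpos : ∀ t : ℝ, 0 ≤ indexForm W n (ξ + t • η) (ξ + t • η)) (h : indexForm W n ξ ξ = 0) :
    indexForm W n ξ η = 0 := by
  simp only [indexForm_add_smul_self W hW, h] at hpos
  have h1 := discrim_le_zero (a := indexForm W n η η) (b := 2 * indexForm W n ξ η) (c := 0)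
    fun t => by linarith [hpos t]
  rw [discrim] at h1
  nlinarith [sq_nonneg (indexForm W n ξ η)]

/-! ### Periodic functions -/

/-- The standard basis of `ℝ^d`, whose `ℤ`-span is `ℤ^d`. -/
noncomputable def stdBasis (d : ℕ) : Module.Basis (Fin d) ℝ (E d) :=
  (EuclideanSpace.basisFun (Fin d) ℝ).toBasis

/-- The half-open unit cube `[0, 1)^d`. -/
noncomputable def unitCube (d : ℕ) : Set (E d) := ZSpan.fundamentalDomain (stdBasis d)

theorem exists_latticeVector_of_mem_span {v : E d}
    (hv : v ∈ Submodule.span ℤ (Set.range (stdBasis d))) : ∃ e, v = latticeVector e := by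
  rw [Module.Basis.mem_span_iff_repr_mem] at hv
  choose e he using hv
  refine ⟨e, ?_⟩
  ext i
  simpa [latticeVector, stdBasis] using (he i).symm

theorem stdBasis_eq_latticeVector (i : Fin d) : stdBasis d i = latticeVector (Pi.single i 1) := by
  ext j
  simp [latticeVector, stdBasis, Pi.single_apply]

/-- A continuous periodic function attains its minimum. -/
theorem exists_forall_le_of_periodic {f : E d → ℝ} (hc : Continuous f)
    (hf : IsLatticePeriodic f) : ∃ q₀, ∀ q, f q₀ ≤ f q := by
  have hK : IsCompact (closure (unitCube d)) :=
    (ZSpan.fundamentalDomain_isBounded (stdBasis d)).isCompact_closure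
  have hmem : ∀ q, ZSpan.fract (stdBasis d) q ∈ closure (unitCube d) := fun q =>
    subset_closure (ZSpan.fract_mem_fundamentalDomain _ q)
  obtain ⟨q₀, -, h⟩ := hK.exists_isMinOn ⟨_, hmem 0⟩ hc.continuousOn
  refine ⟨q₀, fun q => (h (hmem q)).trans_eq ?_⟩
  obtain ⟨e, he⟩ := exists_latticeVector_of_mem_span (ZSpan.floor (stdBasis d) q).2
  have h1 : q = ZSpan.fract (stdBasis d) q + latticeVector e := by
    rw [ZSpan.fract_apply, ← he, sub_add_cancel]
  conv_rhs => rw [h1, hf e]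

/-- A periodic `C²` function with vanishing Hessian is affine, hence constant, as its gradient
vanishes at a minimum. -/
theorem isConstant_of_hess_eq_zero {f : E d → ℝ} (hf : ContDiff ℝ 2 f)
    (hper : IsLatticePeriodic f) (h : ∀ q, hess f q = 0) : IsConstant f := by
  obtain ⟨q₀, hq₀⟩ := exists_forall_le_of_periodic hf.continuous hper
  have h0 : fderiv ℝ f q₀ = 0 := IsLocalMin.fderiv_eq_zero (Eventually.of_forall hq₀)
  have h1 : ∀ q, gradient f q = 0 := fun q => by
    rw [is_const_of_fderiv_eq_zero ((contDiff_gradient hf).differentiable one_ne_zero) h q q₀,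
      gradient, h0, map_zero]
  refine ⟨f 0, fun q => is_const_of_fderiv_eq_zero (hf.differentiable two_ne_zero) (fun x => ?_)
    q 0⟩
  simpa [gradient] using h1 x

/-! ### Orbits -/

/-- The pair of positions at times `j`, `j + 1` on the orbit of the Euler–Lagrange recurrence
with potentials `U` whose positions at times `0` and `1` are `x`. -/
noncomputable def orbitState (U : ℕ → E d → ℝ) (x : E d × E d) : ℕ → E d × E d
  | 0 => x
  | j + 1 => ((orbitState U x j).2, (2 : ℝ) • (orbitState U x j).2 +
      gradient (U (j + 1)) (orbitState U x j).2 - (orbitState U x j).1)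

/-- The position at time `j` on the orbit with initial positions `x`. -/
noncomputable def orbit (U : ℕ → E d → ℝ) (x : E d × E d) (j : ℕ) : E d := (orbitState U x j).1

theorem orbit_succ_succ (U : ℕ → E d → ℝ) (x : E d × E d) (j : ℕ) :
    orbit U x (j + 2) = (2 : ℝ) • orbit U x (j + 1) + gradient (U (j + 1)) (orbit U x (j + 1))
      - orbit U x j := rfl

theorem continuous_orbitState {U : ℕ → E d → ℝ} (hU : ∀ j, ContDiff ℝ 2 (U j)) (j : ℕ) :
    Continuous fun x => orbitState U x j := by
  induction j with
  | zero => exact continuous_id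
  | succ j ih =>
    have h := (contDiff_gradient (hU (j + 1))).continuous
    simp only [orbitState]
    fun_prop

theorem continuous_orbit {U : ℕ → E d → ℝ} (hU : ∀ j, ContDiff ℝ 2 (U j)) (j : ℕ) :
    Continuous fun x => orbit U x j :=
  (continuous_orbitState hU j).fst

theorem recurrence_of_eq_zero {a b c g : E d} (h : (2 : ℝ) • b - a - c + g = 0) :
    c = (2 : ℝ) • b + g - a := by
  rw [eq_comm, ← sub_eq_zero, ← h]
  abel

theorem eq_orbit_of_recurrence {U : ℕ → E d → ℝ} {u : ℕ → E d} {n : ℕ}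
    (h : ∀ i < n, u (i + 2) = (2 : ℝ) • u (i + 1) + gradient (U (i + 1)) (u (i + 1)) - u i) :
    ∀ j ≤ n + 1, u j = orbit U (u 0, u 1) j := by
  intro j
  induction j using Nat.twoStepInduction with
  | zero => exact fun _ => rfl
  | one => exact fun _ => rfl
  | more j h0 h1 =>
    intro hj
    rw [h j (by omega), h0 (by omega), h1 (by omega), orbit_succ_succ]

/-- The Hessians of the potentials along the orbit with initial positions `x`. -/
noncomputable def orbitHess (U : ℕ → E d → ℝ) (x : E d × E d) (j : ℕ) : E d →L[ℝ] E d :=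
  hess (U j) (orbit U x j)

theorem continuous_orbitHess {U : ℕ → E d → ℝ} (hU : ∀ j, ContDiff ℝ 2 (U j)) (j : ℕ) :
    Continuous fun x => orbitHess U x j :=
  (continuous_hess (hU j)).comp (continuous_orbit hU j)

/-! ### Minimizers of the action on a segment with fixed endpoints -/

/-- The sequence with values `u` at the times `1, …, n` and zero at all other times. -/
def zeroExtend {n : ℕ} (u : Fin n → E d) : ℕ → E d
  | 0 => 0
  | j + 1 => if h : j < n then u ⟨j, h⟩ else 0

@[simp] theorem zeroExtend_zero {n : ℕ} (u : Fin n → E d) : zeroExtend u 0 = 0 := rfl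

@[simp] theorem zeroExtend_last {n : ℕ} (u : Fin n → E d) : zeroExtend u (n + 1) = 0 := by
  simp [zeroExtend]

theorem zeroExtend_succ {n : ℕ} (u : Fin n → E d) (i : Fin n) :
    zeroExtend u (i + 1) = u i := by
  simp [zeroExtend]

theorem zeroExtend_add_smul {n : ℕ} (u v : Fin n → E d) (t : ℝ) :
    zeroExtend (u + t • v) = zeroExtend u + t • zeroExtend v := by
  funext j
  cases j with
  | zero => simp
  | succ j => by_cases h : j < n <;> simp [zeroExtend, h]

theorem continuous_zeroExtend {n : ℕ} (j : ℕ) :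
    Continuous fun u : Fin n → E d => zeroExtend u j := by
  cases j with
  | zero => exact continuous_const
  | succ j =>
    by_cases h : j < n
    · simpa [zeroExtend, h] using continuous_apply _
    · simpa [zeroExtend, h] using continuous_const

theorem zeroExtend_restrict {n : ℕ} {ξ : ℕ → E d} (h0 : ξ 0 = 0) (hn : ξ (n + 1) = 0) :
    ∀ j ≤ n + 1, zeroExtend (fun i : Fin n => ξ (i + 1)) j = ξ j := by
  intro j hj
  cases j with
  | zero => exact h0.symm
  | succ j =>
    by_cases h : j < n
    · simp [zeroExtend, h]
    · obtain rfl : j = n := by omega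
      rw [zeroExtend_last, hn]

theorem eq_zero_of_forall_sum_inner_zeroExtend {n : ℕ} {w : ℕ → E d}
    (h : ∀ v : Fin n → E d, ∑ i ∈ Finset.range n, ⟪w i, zeroExtend v (i + 1)⟫ = 0) :
    ∀ i < n, w i = 0 := by
  have h' : ∑ i ∈ Finset.range n, ⟪w i, w i⟫ = 0 := by
    rw [← h fun i => w i]
    refine Finset.sum_congr rfl fun i hi => ?_
    rw [show zeroExtend (fun i : Fin n => w i) (i + 1) = w i from
      zeroExtend_succ (fun i : Fin n => w i) ⟨i, Finset.mem_range.1 hi⟩]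
  rw [Finset.sum_eq_zero_iff_of_nonneg fun _ _ => real_inner_self_nonneg] at h'
  exact fun i hi => inner_self_eq_zero.1 (h' i (Finset.mem_range.2 hi))

/-- The action of the segment of `ξ` over the times `0, …, n + 1`. -/
noncomputable def action (U : ℕ → E d → ℝ) (n : ℕ) (ξ : ℕ → E d) : ℝ :=
  ∑ j ∈ Finset.range (n + 1), (1 / 2 * ‖ξ (j + 1) - ξ j‖ ^ 2 + U j (ξ j))

/-- The first variation of the action at `ξ` in the direction `η`. -/
noncomputable def firstVariation (U : ℕ → E d → ℝ) (n : ℕ) (ξ η : ℕ → E d) : ℝ :=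
  ∑ j ∈ Finset.range (n + 1),
    (⟪ξ (j + 1) - ξ j, η (j + 1) - η j⟫ + ⟪gradient (U j) (ξ j), η j⟫)

theorem hasDerivAt_action {U : ℕ → E d → ℝ} (hU : ∀ j, ContDiff ℝ 2 (U j)) (n : ℕ)
    (ξ η : ℕ → E d) (t : ℝ) :
    HasDerivAt (fun s : ℝ => action U n (ξ + s • η)) (firstVariation U n (ξ + t • η) η) t := by
  have hline : ∀ a b : E d, HasDerivAt (fun s : ℝ => a + s • b) b t := fun a b => by
    simpa using ((hasDerivAt_id t).smul_const b).const_add a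
  refine HasDerivAt.fun_sum fun j _ => HasDerivAt.add ?_ ?_
  · have h := (hline (ξ (j + 1)) (η (j + 1))).sub (hline (ξ j) (η j))
    convert! h.norm_sq.const_mul (1 / 2 : ℝ) using 1
    simp
  · have h := ((hU j).differentiable two_ne_zero (ξ j + t • η j)).hasGradientAt
    rw [hasGradientAt_iff_hasFDerivAt] at h
    exact h.comp_hasDerivAt t (hline (ξ j) (η j))

theorem hasDerivAt_firstVariation {U : ℕ → E d → ℝ} (hU : ∀ j, ContDiff ℝ 2 (U j)) (n : ℕ)
    (ξ η : ℕ → E d) :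
    HasDerivAt (fun s : ℝ => firstVariation U n (ξ + s • η) η)
      (indexForm (fun j => hess (U j) (ξ j)) n η η) 0 := by
  have hline : ∀ a b : E d, HasDerivAt (fun s : ℝ => a + s • b) b 0 := fun a b => by
    simpa using ((hasDerivAt_id (0 : ℝ)).smul_const b).const_add a
  refine HasDerivAt.fun_sum fun j _ => HasDerivAt.add ?_ ?_
  · have h := (hline (ξ (j + 1)) (η (j + 1))).sub (hline (ξ j) (η j))
    simpa using h.inner ℝ (hasDerivAt_const (0 : ℝ) (η (j + 1) - η j))
  · have h := hasFDerivAt_gradient (hU j) (ξ j + (0 : ℝ) • η j)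
    have h2 := (h.comp_hasDerivAt (0 : ℝ) (hline (ξ j) (η j))).inner ℝ
      (hasDerivAt_const (0 : ℝ) (η j))
    simpa using h2

/-- The action with both endpoints at the origin is coercive, since the length of the steps
controls the positions. -/
theorem exists_action_minimizer {U : ℕ → E d → ℝ} (hc : ∀ j, Continuous (U j))
    (hper : ∀ j, IsLatticePeriodic (U j)) (n : ℕ) :
    ∃ u : Fin n → E d, ∀ v : Fin n → E d,
      action U n (zeroExtend u) ≤ action U n (zeroExtend v) := by
  choose q hq using fun j => exists_forall_le_of_periodic (hc j) (hper j)
  set c : ℝ := ∑ j ∈ Finset.range (n + 1), U j (q j) with hcdef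
  have hcont : Continuous fun u : Fin n → E d => action U n (zeroExtend u) := by
    have h := fun j => continuous_zeroExtend (d := d) (n := n) j
    unfold action
    fun_prop
  refine hcont.exists_forall_le ?_
  have hbound : ∀ u : Fin n → E d,
      1 / 2 * (‖u‖ ^ 2 / (n + 1)) + c ≤ action U n (zeroExtend u) := by
    intro u
    set S : ℝ := ∑ j ∈ Finset.range (n + 1), ‖zeroExtend u (j + 1) - zeroExtend u j‖ with hS
    have hS0 : 0 ≤ S := Finset.sum_nonneg fun _ _ => norm_nonneg _
    have hu : ‖u‖ ≤ S := by
      rw [pi_norm_le_iff_of_nonneg hS0]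
      intro i
      rw [← zeroExtend_succ u i, ← sub_zero (zeroExtend u (i + 1)), ← zeroExtend_zero u,
        ← Finset.sum_range_sub]
      refine (norm_sum_le _ _).trans
        (Finset.sum_le_sum_of_subset_of_nonneg ?_ fun _ _ _ => norm_nonneg _)
      exact Finset.range_mono (by omega)
    have h1 : S ^ 2 ≤ (n + 1) *
        ∑ j ∈ Finset.range (n + 1), ‖zeroExtend u (j + 1) - zeroExtend u j‖ ^ 2 := by
      simpa using sq_sum_le_card_mul_sum_sq (s := Finset.range (n + 1))
        (f := fun j => ‖zeroExtend u (j + 1) - zeroExtend u j‖)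
    have h2 : ‖u‖ ^ 2 / (n + 1) ≤
        ∑ j ∈ Finset.range (n + 1), ‖zeroExtend u (j + 1) - zeroExtend u j‖ ^ 2 := by
      rw [div_le_iff₀' (by positivity)]
      exact (pow_le_pow_left₀ (norm_nonneg _) hu 2).trans h1
    rw [action, Finset.sum_add_distrib, ← Finset.mul_sum]
    exact add_le_add (by linarith) (Finset.sum_le_sum fun j _ => hq j _)
  refine tendsto_atTop_mono hbound (tendsto_atTop_add_const_right _ _ ?_)
  refine Tendsto.const_mul_atTop (by norm_num) (Tendsto.atTop_div_const (by positivity) ?_)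
  exact (tendsto_pow_atTop two_ne_zero).comp (tendsto_norm_cocompact_atTop (E := Fin n → E d))

/-- The orbit through a minimizer of the action with fixed endpoints has nonnegative index form. -/
theorem exists_orbit_indexForm_nonneg {U : ℕ → E d → ℝ} (hU : ∀ j, ContDiff ℝ 2 (U j))
    (hper : ∀ j, IsLatticePeriodic (U j)) (n : ℕ) :
    ∃ x, ∀ v : Fin n → E d,
      0 ≤ indexForm (orbitHess U x) n (zeroExtend v) (zeroExtend v) := by
  obtain ⟨u, hu⟩ := exists_action_minimizer (fun j => (hU j).continuous) hper n
  set ξ := zeroExtend u with hξ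
  have hmin : ∀ v : Fin n → E d,
      IsLocalMin (fun s : ℝ => action U n (ξ + s • zeroExtend v)) 0 := fun v =>
    Eventually.of_forall fun s => by
      simpa [hξ, ← zeroExtend_add_smul] using hu (u + s • v)
  have hderiv : ∀ v : Fin n → E d, deriv (fun s : ℝ => action U n (ξ + s • zeroExtend v)) =
      fun s => firstVariation U n (ξ + s • zeroExtend v) (zeroExtend v) := fun v =>
    funext fun t => (hasDerivAt_action hU n ξ (zeroExtend v) t).deriv
  have hfirst : ∀ v : Fin n → E d, firstVariation U n ξ (zeroExtend v) = 0 := fun v => by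
    have h := (hmin v).deriv_eq_zero
    rw [hderiv] at h
    simpa using h
  have hsecond : ∀ v : Fin n → E d,
      0 ≤ indexForm (fun j => hess (U j) (ξ j)) n (zeroExtend v) (zeroExtend v) := by
    intro v
    by_contra! hneg
    -- the second derivative test would make the minimum a maximum too, so the action would be
    -- locally constant along the line
    have hdd : deriv (deriv fun s : ℝ => action U n (ξ + s • zeroExtend v)) 0 < 0 := by
      rwa [hderiv, (hasDerivAt_firstVariation hU n ξ (zeroExtend v)).deriv]
    have hmax := isLocalMax_of_deriv_deriv_neg hdd (hmin v).deriv_eq_zero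
      (hasDerivAt_action hU n ξ (zeroExtend v) 0).continuousAt
    have hconst : (fun s : ℝ => action U n (ξ + s • zeroExtend v)) =ᶠ[𝓝 0]
        fun _ => action U n (ξ + (0 : ℝ) • zeroExtend v) := by
      filter_upwards [hmin v, hmax] with s h1 h2 using le_antisymm h2 h1
    have h0 := hconst.deriv.deriv_eq
    simp only [deriv_const'] at h0
    rw [h0] at hdd
    simp at hdd
  have hrec : ∀ i < n,
      ξ (i + 2) = (2 : ℝ) • ξ (i + 1) + gradient (U (i + 1)) (ξ (i + 1)) - ξ i := by
    intro i hi
    refine recurrence_of_eq_zero (eq_zero_of_forall_sum_inner_zeroExtend (w := fun i =>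
      (2 : ℝ) • ξ (i + 1) - ξ i - ξ (i + 2) + gradient (U (i + 1)) (ξ (i + 1))) (fun v => ?_) i hi)
    have h := hfirst v
    rw [firstVariation, Finset.sum_add_distrib, sum_inner_diff _ _ _ (zeroExtend_zero _),
      zeroExtend_last, inner_zero_right, add_zero,
      sum_inner_shift (fun j => gradient (U j) (ξ j)) _ _ (zeroExtend_zero _),
      ← Finset.sum_add_distrib] at h
    simpa only [← inner_add_left] using h
  refine ⟨(ξ 0, ξ 1), fun v => (hsecond v).trans_eq ?_⟩
  refine Finset.sum_congr rfl fun j hj => ?_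
  rw [orbitHess, ← eq_orbit_of_recurrence hrec j (Finset.mem_range.1 hj).le]

/-! ### Positivity of the index form in the absence of conjugate points -/

/-- If on no orbit a nontrivial Jacobi field vanishes at both ends of a segment, then the index
form is nonnegative on every orbit: a nonnegative form is then positive definite, so nonnegativity
is an open and closed condition on the initial positions, and it holds on some orbit. -/
theorem indexForm_nonneg {U : ℕ → E d → ℝ} (hU : ∀ j, ContDiff ℝ 2 (U j))
    (hper : ∀ j, IsLatticePeriodic (U j)) (n : ℕ)
    (hconj : ∀ x, ∀ ξ : ℕ → E d, ξ 0 = 0 → ξ (n + 1) = 0 →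
      (∀ i < n, ξ (i + 2) = (2 : ℝ) • ξ (i + 1) + orbitHess U x (i + 1) (ξ (i + 1)) - ξ i) →
      ∀ j ≤ n + 1, ξ j = 0)
    (x : E d × E d) (ξ : ℕ → E d) (h0 : ξ 0 = 0) (hn : ξ (n + 1) = 0) :
    0 ≤ indexForm (orbitHess U x) n ξ ξ := by
  set B : E d × E d → (Fin n → E d) → ℝ := fun x v =>
    indexForm (orbitHess U x) n (zeroExtend v) (zeroExtend v) with hB
  have hsymm : ∀ x j u v, ⟪orbitHess U x j u, v⟫ = ⟪orbitHess U x j v, u⟫ := fun x j u v =>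
    inner_hess_comm (hU j) _ u v
  have hcont : Continuous fun p : (E d × E d) × (Fin n → E d) => B p.1 p.2 := by
    have h1 := fun j => (continuous_zeroExtend (d := d) (n := n) j).comp
      (continuous_snd (X := E d × E d))
    have h2 := fun j => (continuous_orbitHess hU j).comp
      (continuous_fst (Y := Fin n → E d))
    refine continuous_finsetSum _ fun j _ => Continuous.add ?_ ?_
    · exact ((h1 (j + 1)).sub (h1 j)).inner ((h1 (j + 1)).sub (h1 j))
    · exact ((h2 j).clm_apply (h1 j)).inner (h1 j)
  have hsmul : ∀ x (t : ℝ) v, B x (t • v) = t ^ 2 * B x v := by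
    intro x t v
    have hz : zeroExtend (t • v) = t • zeroExtend v := by
      have := zeroExtend_add_smul 0 v t
      have h00 : zeroExtend (0 : Fin n → E d) = 0 := by
        funext j
        cases j with
        | zero => rfl
        | succ j => simp [zeroExtend]
      simpa [h00] using this
    simp only [hB, hz, indexForm, Finset.mul_sum]
    refine Finset.sum_congr rfl fun j _ => ?_
    simp only [Pi.smul_apply, ← smul_sub, map_smul, real_inner_smul_left, real_inner_smul_right]
    ring
  have hpos : ∀ x, (∀ v, 0 ≤ B x v) → ∀ v, v ≠ 0 → 0 < B x v := by
    intro x hx v hv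
    refine (hx v).lt_of_ne fun hzero => hv ?_
    set η := zeroExtend v with hη
    have hker : ∀ w : Fin n → E d, indexForm (orbitHess U x) n η (zeroExtend w) = 0 := fun w =>
      indexForm_eq_zero_of_nonneg _ (hsymm x) n _ _
        (fun t => by rw [hη, ← zeroExtend_add_smul]; exact hx _) hzero.symm
    have hrec : ∀ i < n,
        η (i + 2) = (2 : ℝ) • η (i + 1) + orbitHess U x (i + 1) (η (i + 1)) - η i := by
      intro i hi
      refine recurrence_of_eq_zero (eq_zero_of_forall_sum_inner_zeroExtend (w := fun i =>
        (2 : ℝ) • η (i + 1) - η i - η (i + 2) + orbitHess U x (i + 1) (η (i + 1)))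
        (fun v => ?_) i hi)
      rw [← indexForm_eq_sum _ _ _ _ (zeroExtend_zero _) (zeroExtend_last _)]
      exact hker v
    have hall := hconj x η (zeroExtend_zero v) (zeroExtend_last v) hrec
    funext i
    rw [← zeroExtend_succ v i]
    exact hall _ (by omega)
  have hclosed : IsClosed {x | ∀ v, 0 ≤ B x v} := by
    have hBx : ∀ v, Continuous fun x => B x v := fun v =>
      Continuous.comp (f := fun x => (x, v)) hcont (by fun_prop)
    rw [Set.ofPred_forall]
    exact isClosed_iInter fun v => isClosed_le continuous_const (hBx v)
  have hopen : IsOpen {x | ∀ v, 0 ≤ B x v} := by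
    rw [isOpen_iff_mem_nhds]
    intro x hx
    have hev : ∀ᶠ y in 𝓝 x, ∀ v ∈ Metric.sphere (0 : Fin n → E d) 1, 0 < B y v := by
      refine (isCompact_sphere (0 : Fin n → E d) 1).eventually_forall_of_forall_eventually ?_
      intro v hv
      exact hcont.continuousAt.eventually (lt_mem_nhds
        (hpos x hx v (ne_zero_of_mem_unit_sphere ⟨v, hv⟩)))
    filter_upwards [hev] with y hy v
    rcases eq_or_ne v 0 with rfl | hv
    · rw [← zero_smul ℝ (0 : Fin n → E d), hsmul]
      simp
    · have h1 : v = ‖v‖ • (‖v‖⁻¹ • v) := by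
        rw [smul_smul, mul_inv_cancel₀ (norm_ne_zero_iff.2 hv), one_smul]
      rw [h1, hsmul]
      refine mul_nonneg (sq_nonneg _) (hy _ ?_).le
      simp [norm_smul, norm_ne_zero_iff.2 hv]
  have huniv := IsClopen.eq_univ ⟨hclosed, hopen⟩ (exists_orbit_indexForm_nonneg hU hper n)
  have hx : x ∈ {x | ∀ v, 0 ≤ B x v} := huniv ▸ Set.mem_univ x
  refine (hx fun i => ξ (i + 1)).trans_eq (Finset.sum_congr rfl fun j hj => ?_)
  rw [Finset.mem_range] at hj
  rw [zeroExtend_restrict h0 hn _ (by omega), zeroExtend_restrict h0 hn _ (by omega)]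

/-! ### Averages over the torus -/

theorem isLatticePeriodic_of_mem_span {f : E d → ℝ} (hf : IsLatticePeriodic f) {v : E d}
    (hv : v ∈ Submodule.span ℤ (Set.range (stdBasis d))) (q : E d) : f (v + q) = f q := by
  obtain ⟨e, rfl⟩ := exists_latticeVector_of_mem_span hv
  rw [add_comm, hf e]

instance : VAddInvariantMeasure (Submodule.span ℤ (Set.range (stdBasis d))) (E d) volume :=
  inferInstanceAs (VAddInvariantMeasure
    (Submodule.span ℤ (Set.range (stdBasis d))).toAddSubgroup (E d) volume)

/-- The integral of a periodic function over a period is invariant under point reflections, as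
these map fundamental domains of `ℤ^d` to fundamental domains. -/
theorem integral_unitCube_sub_left {f : E d → ℝ} (hf : IsLatticePeriodic f) (c : E d) :
    ∫ a in unitCube d, f (c - a) = ∫ a in unitCube d, f a := by
  have hF := ZSpan.isAddFundamentalDomain (stdBasis d) volume
  have hmp := Measure.measurePreserving_sub_left (volume : Measure (E d)) c
  have hF' := hF.preimage_of_equiv (f := fun a => c - a) hmp.quasiMeasurePreserving
    (Equiv.neg _).bijective fun g a => by
      simp only [Submodule.vadd_def, vadd_eq_add, Equiv.neg_apply, Submodule.coe_neg]
      abel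
  have h1 := hF.setIntegral_eq hF' (f := fun a => f (c - a)) fun g a => by
    have := isLatticePeriodic_of_mem_span hf (neg_mem g.2) (c - a)
    rw [← this]
    simp only [Submodule.vadd_def, vadd_eq_add]
    congr 1
    abel
  have h2 := hmp.setIntegral_preimage_emb
    ((MeasurableEquiv.subLeft c).measurableEmbedding) f (unitCube d)
  exact h1.trans h2

theorem integral_unitCube_add_right {f : E d → ℝ} (hf : IsLatticePeriodic f) (c : E d) :
    ∫ a in unitCube d, f (a + c) = ∫ a in unitCube d, f a := by
  have hf' : IsLatticePeriodic fun a => f (c - a) := fun e a => by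
    have h : c - (a + latticeVector e) = c - a + -latticeVector e := by abel
    simp only [h]
    exact (hf e).neg (c - a)
  rw [← integral_unitCube_sub_left hf c, ← integral_unitCube_sub_left hf' 0]
  simp [add_comm]

theorem integrable_prod_restrict_of_isBounded {X Y : Type*} [MetricSpace X] [ProperSpace X]
    [SecondCountableTopology X] [MetricSpace Y] [ProperSpace Y] [MeasureSpace X]
    [BorelSpace X] [MeasureSpace Y] [BorelSpace Y] [SecondCountableTopology Y]
    [SFinite (volume : Measure X)] [SFinite (volume : Measure Y)]
    [IsFiniteMeasureOnCompacts (volume : Measure (X × Y))] {s : Set X} {t : Set Y}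
    (hs : Bornology.IsBounded s) (ht : Bornology.IsBounded t) {g : X × Y → ℝ}
    (hg : Continuous g) : Integrable g ((volume.restrict s).prod (volume.restrict t)) := by
  rw [Measure.prod_restrict]
  exact (hg.continuousOn.integrableOn_compact (hs.prod ht).isCompact_closure).mono_set
    subset_closure

theorem isBounded_unitCube (d : ℕ) : Bornology.IsBounded (unitCube d) :=
  ZSpan.fundamentalDomain_isBounded _

instance : IsFiniteMeasure (volume.restrict (unitCube d)) :=
  ⟨by simpa using (isBounded_unitCube d).measure_lt_top⟩

/-- Lebesgue measure on pairs of points of the unit cube, that is, on the torus of dimension `2d`. -/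
noncomputable abbrev torusMeasure (d : ℕ) : Measure (E d × E d) :=
  (volume.restrict (unitCube d)).prod (volume.restrict (unitCube d))

theorem integrable_torusMeasure {g : E d × E d → ℝ} (hg : Continuous g) :
    Integrable g (torusMeasure d) :=
  integrable_prod_restrict_of_isBounded (isBounded_unitCube d) (isBounded_unitCube d) hg

/-- The Euler–Lagrange dynamics on pairs of consecutive positions descends to the torus of
dimension `2d` and preserves its Lebesgue measure. -/
theorem integral_orbitState {U : ℕ → E d → ℝ} (hU : ∀ j, ContDiff ℝ 2 (U j))
    (hper : ∀ j, IsLatticePeriodic (U j)) (j : ℕ) {g : E d × E d → ℝ} (hg : Continuous g)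
    (hg1 : ∀ b, IsLatticePeriodic fun a => g (a, b))
    (hg2 : ∀ a, IsLatticePeriodic fun b => g (a, b)) :
    ∫ x, g (orbitState U x j) ∂torusMeasure d = ∫ x, g x ∂torusMeasure d := by
  induction j generalizing g with
  | zero => rfl
  | succ j ih =>
    set f : E d → E d := fun b => (2 : ℝ) • b + gradient (U (j + 1)) b with hf
    have hfc : Continuous f := by
      have := (contDiff_gradient (hU (j + 1))).continuous
      fun_prop
    have hg' : Continuous fun x : E d × E d => g (x.2, f x.2 - x.1) := by fun_prop
    have h1 := ih (g := fun x => g (x.2, f x.2 - x.1)) hg'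
      (fun b e a => by
        have h2 : f b - (a + latticeVector e) = f b - a + -latticeVector e := by abel
        simp only [h2]
        exact (hg2 b e).neg (f b - a))
      (fun a e b => by
        simp only
        have h2 : f (b + latticeVector e) - a = f b - a + latticeVector e + latticeVector e := by
          simp only [hf, gradient_add_latticeVector (hper _), two_smul]
          abel
        have h3 := fun c => hg1 c e b
        have h4 := hg2 b e
        simp only at h3
        rw [h2, h3]
        exact (h4 _).trans (h4 _))
    refine h1.trans ?_
    rw [integral_prod_symm _ (integrable_torusMeasure hg'), integral_prod _
      (integrable_torusMeasure hg)]
    exact integral_congr_ae (Eventually.of_forall fun b =>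
      integral_unitCube_sub_left (hg2 b) (f b))

theorem integral_orbit {U : ℕ → E d → ℝ} (hU : ∀ j, ContDiff ℝ 2 (U j))
    (hper : ∀ j, IsLatticePeriodic (U j)) (j : ℕ) {g : E d → ℝ} (hg : Continuous g)
    (hgper : IsLatticePeriodic g) :
    ∫ x, g (orbit U x j) ∂torusMeasure d =
      volume.real (unitCube d) * ∫ q in unitCube d, g q := by
  have h := integral_orbitState hU hper j (g := fun x => g x.1) (hg.comp continuous_fst)
    (fun _ => hgper) (fun _ _ _ => rfl)
  refine h.trans ?_
  rw [integral_fun_fst]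
  simp

/-- Second derivatives of a periodic function in the coordinate directions have mean zero. -/
theorem integral_hess_stdBasis {f : E d → ℝ} (hf : ContDiff ℝ 2 f) (hper : IsLatticePeriodic f)
    (i : Fin d) : ∫ q in unitCube d, ⟪hess f q (stdBasis d i), stdBasis d i⟫ = 0 := by
  set e := stdBasis d i with he
  set h : E d → ℝ := fun q => ⟪hess f q e, e⟫ with hh
  have hc : Continuous h := ((continuous_hess hf).clm_apply continuous_const).inner continuous_const
  have hper' : IsLatticePeriodic h := fun v q => by simp only [hh, hess_add_latticeVector hper]
  have hline : ∀ q, ∫ t in Set.Ioc (0 : ℝ) 1, h (q + t • e) = 0 := by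
    intro q
    have hd : ∀ t : ℝ, HasDerivAt (fun t : ℝ => ⟪gradient f (q + t • e), e⟫) (h (q + t • e)) t := by
      intro t
      have hl : HasDerivAt (fun s : ℝ => q + s • e) e t := by
        simpa using ((hasDerivAt_id t).smul_const e).const_add q
      simpa using ((hasFDerivAt_gradient hf _).comp_hasDerivAt t hl).inner ℝ (hasDerivAt_const t e)
    rw [← intervalIntegral.integral_of_le zero_le_one,
      intervalIntegral.integral_eq_sub_of_hasDerivAt (fun t _ => hd t)
        (Continuous.intervalIntegrable (by fun_prop) _ _), he, stdBasis_eq_latticeVector]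
    simp [gradient_add_latticeVector hper]
  have hswap := integral_integral_swap (f := fun (q : E d) (t : ℝ) => h (q + t • e))
    (integrable_prod_restrict_of_isBounded (isBounded_unitCube d)
      (Metric.isBounded_Ioc (0 : ℝ) 1) (by unfold Function.uncurry; fun_prop))
  simp only [hline, integral_zero, integral_unitCube_add_right hper'] at hswap
  simpa using hswap.symm

theorem eq_zero_of_integral_nonpos {f : E d → ℝ} (hc : Continuous f) (hper : IsLatticePeriodic f)
    (h0 : ∀ q, 0 ≤ f q) (h : ∫ q in unitCube d, f q ≤ 0) (q : E d) : f q = 0 := by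
  have hint : IntegrableOn f (unitCube d) :=
    (hc.continuousOn.integrableOn_compact (isBounded_unitCube d).isCompact_closure).mono_set
      subset_closure
  have h1 : ∫ q in unitCube d, f q = 0 := le_antisymm h (integral_nonneg h0)
  rw [integral_eq_zero_iff_of_nonneg h0 hint] at h1
  have hmeas : volume ({q | f q ≠ 0} ∩ unitCube d) = 0 := by
    rw [Filter.EventuallyEq, ae_iff, Measure.restrict_apply
      (by exact (isOpen_ne_fun hc continuous_const).measurableSet)] at h1
    exact h1
  have hF := ZSpan.isAddFundamentalDomain (stdBasis d) volume
  have hall := hF.measure_zero_of_invariant {q | f q ≠ 0} (fun g => by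
    ext q
    rw [Set.mem_vadd_set_iff_neg_vadd_mem]
    simp only [Set.mem_ofPred_eq, Submodule.vadd_def, vadd_eq_add,
      isLatticePeriodic_of_mem_span hper (-g).2]) hmeas
  exact congrFun (Continuous.ae_eq_iff_eq volume hc continuous_const |>.1 (ae_iff.2 hall)) q

/-! ### The test field -/

/-- The piecewise linear cutoff that vanishes at the times `0` and `2M + 2`, equals one at the times
`M`, `M + 1`, `M + 2`, and has slopes `± 1 / M` in between. -/
noncomputable def cutoff (M j : ℕ) : ℝ := min 1 (min (j / M) ((2 * M + 2 - j) / M))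

theorem cutoff_zero (M : ℕ) : cutoff M 0 = 0 := by
  rw [cutoff, Nat.cast_zero, zero_div, sub_zero, min_eq_left (a := (0 : ℝ)) (by positivity)]
  simp

theorem cutoff_last (M : ℕ) : cutoff M (2 * M + 2) = 0 := by
  have h : (2 * (M : ℝ) + 2 - ((2 * M + 2 : ℕ) : ℝ)) / M = 0 := by push_cast; simp
  rw [cutoff, h, min_eq_right (a := ((2 * M + 2 : ℕ) : ℝ) / M) (by positivity)]
  simp

theorem cutoff_eq_one {M j : ℕ} (hM : 0 < M) (h1 : M ≤ j) (h2 : j ≤ M + 2) : cutoff M j = 1 := by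
  have hM' : (0 : ℝ) < M := by exact_mod_cast hM
  have h1' : (M : ℝ) ≤ j := by exact_mod_cast h1
  have h2' : (j : ℝ) ≤ M + 2 := by exact_mod_cast h2
  refine min_eq_left (le_min ?_ ?_)
  · rwa [le_div_iff₀ hM', one_mul]
  · rw [le_div_iff₀ hM']
    linarith

theorem sum_sq_cutoff_diff_le {M : ℕ} (hM : 0 < M) :
    ∑ j ∈ Finset.range (2 * M + 2), (cutoff M (j + 1) - cutoff M j) ^ 2 ≤ 4 / M := by
  have hM' : (1 : ℝ) ≤ M := by exact_mod_cast hM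
  have hstep : ∀ j, |cutoff M (j + 1) - cutoff M j| ≤ 1 / M := by
    intro j
    refine (abs_min_sub_min_le_max _ _ _ _).trans (max_le (by simp) ?_)
    refine (abs_min_sub_min_le_max _ _ _ _).trans (max_le ?_ ?_)
    · rw [← sub_div, abs_div, Nat.abs_cast]
      simp
    · rw [← sub_div, abs_div, Nat.abs_cast]
      push_cast
      rw [show (2 * (M : ℝ) + 2 - (j + 1) - (2 * M + 2 - j)) = -1 by ring]
      simp
  calc _ ≤ ∑ j ∈ Finset.range (2 * M + 2), (1 / (M : ℝ)) ^ 2 :=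
        Finset.sum_le_sum fun j _ => by
          rw [← sq_abs]
          exact pow_le_pow_left₀ (abs_nonneg _) (hstep j) 2
    _ = (2 * M + 2) / (M : ℝ) ^ 2 := by
        simp; ring
    _ ≤ 4 / M := by
        rw [div_le_div_iff₀ (by positivity) (by positivity)]
        nlinarith

/-- The cutoff of the constant field `e`, corrected at the single time `M + 1` by `-ε • h`. -/
noncomputable def testField (M : ℕ) (e h : E d) (ε : ℝ) : ℕ → E d :=
  (fun j => cutoff M j • e) + (-ε) • (Pi.single (M + 1) h : ℕ → E d)

theorem testField_zero (M : ℕ) (e h : E d) (ε : ℝ) : testField M e h ε 0 = 0 := by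
  simp [testField, cutoff_zero]

theorem testField_last (M : ℕ) (e h : E d) (ε : ℝ) : testField M e h ε (2 * M + 2) = 0 := by
  have h1 : (Pi.single (M + 1) h : ℕ → E d) (2 * M + 2) = 0 := Pi.single_eq_of_ne (by omega) _
  simp only [testField, Pi.add_apply, Pi.smul_apply, h1, cutoff_last, zero_smul, smul_zero,
    add_zero]

/-- The correction `h` is the value at time `M + 1` of the Jacobi operator on the cutoff of `e`, so
the term of first order in `ε` is `-2 ε ‖h‖²`. -/
theorem indexForm_testField (W : ℕ → E d →L[ℝ] E d) (hW : ∀ j u v, ⟪W j u, v⟫ = ⟪W j v, u⟫)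
    {M : ℕ} (hM : 0 < M) (e : E d) (ε : ℝ) :
    indexForm W (2 * M + 1) (testField M e (W (M + 1) e) ε) (testField M e (W (M + 1) e) ε) =
      ‖e‖ ^ 2 * ∑ j ∈ Finset.range (2 * M + 2), (cutoff M (j + 1) - cutoff M j) ^ 2
        + ∑ j ∈ Finset.range (2 * M + 2), cutoff M j ^ 2 * ⟪W j e, e⟫
        - 2 * ε * ‖W (M + 1) e‖ ^ 2
        + ε ^ 2 * (2 * ‖W (M + 1) e‖ ^ 2 + ⟪W (M + 1) (W (M + 1) e), W (M + 1) e⟫) := by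
  set h := W (M + 1) e with hh
  set δ : ℕ → E d := Pi.single (M + 1) h with hδ
  have hδ0 : δ 0 = 0 := by simp [hδ]
  have hδn : δ (2 * M + 1 + 1) = 0 := Pi.single_eq_of_ne (by omega) _
  have hδM : δ (M + 1) = h := Pi.single_eq_same _ _
  have hδM0 : δ M = 0 := Pi.single_eq_of_ne (by omega) _
  have hδM2 : δ (M + 2) = 0 := Pi.single_eq_of_ne (by omega) _
  have hB : ∀ η : ℕ → E d, indexForm W (2 * M + 1) η δ =
      ⟪(2 : ℝ) • η (M + 1) - η M - η (M + 2) + W (M + 1) (η (M + 1)), h⟫ := by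
    intro η
    rw [indexForm_eq_sum _ _ _ _ hδ0 hδn, Finset.sum_eq_single_of_mem M
      (Finset.mem_range.2 (by omega)), hδM]
    intro i _ hi
    rw [show δ (i + 1) = 0 from Pi.single_eq_of_ne (by omega) _, inner_zero_right]
  have h1 : indexForm W (2 * M + 1) (fun j => cutoff M j • e) (fun j => cutoff M j • e) =
      ‖e‖ ^ 2 * ∑ j ∈ Finset.range (2 * M + 2), (cutoff M (j + 1) - cutoff M j) ^ 2
        + ∑ j ∈ Finset.range (2 * M + 2), cutoff M j ^ 2 * ⟪W j e, e⟫ := by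
    rw [indexForm, Finset.mul_sum, ← Finset.sum_add_distrib]
    refine Finset.sum_congr rfl fun j _ => ?_
    rw [← sub_smul, map_smul, real_inner_smul_left, real_inner_smul_right, real_inner_smul_left,
      real_inner_smul_right, real_inner_self_eq_norm_sq]
    ring
  have h2 : indexForm W (2 * M + 1) (fun j => cutoff M j • e) δ = ‖h‖ ^ 2 := by
    rw [hB, cutoff_eq_one hM le_rfl (by omega), cutoff_eq_one hM (by omega) (by omega),
      cutoff_eq_one hM (by omega) le_rfl, ← real_inner_self_eq_norm_sq, one_smul, two_smul]
    congr 1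
    rw [← hh]
    abel
  have h3 : indexForm W (2 * M + 1) δ δ = 2 * ‖h‖ ^ 2 + ⟪W (M + 1) h, h⟫ := by
    rw [hB, hδM, hδM0, hδM2, sub_zero, sub_zero, inner_add_left, real_inner_smul_left,
      real_inner_self_eq_norm_sq]
  rw [testField, indexForm_add_smul_self W hW, h1, h2, h3]
  ring

theorem nonpos_of_forall_le {C I J : ℝ}
    (h : ∀ M : ℕ, 0 < M → ∀ ε : ℝ, 0 < ε → 0 ≤ C / M - 2 * ε * I + ε ^ 2 * J) : I ≤ 0 := by
  have h1 : ∀ ε : ℝ, 0 < ε → 0 ≤ -2 * I + ε * J := by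
    intro ε hε
    have hlim : Tendsto (fun M : ℕ => C / (M : ℝ) - 2 * ε * I + ε ^ 2 * J) atTop
        (𝓝 (0 - 2 * ε * I + ε ^ 2 * J)) :=
      ((tendsto_const_div_atTop_nhds_zero_nat C).sub_const _).add_const _
    have h2 := ge_of_tendsto hlim ((eventually_gt_atTop 0).mono fun M hM => h M hM ε hε)
    nlinarith
  have hlim : Tendsto (fun ε : ℝ => -2 * I + ε * J) (𝓝[>] 0) (𝓝 (-2 * I + 0 * J)) :=
    Tendsto.mono_left (Continuous.tendsto (by fun_prop) 0) nhdsWithin_le_nhds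
  have h2 := ge_of_tendsto hlim (eventually_mem_nhdsWithin.mono fun ε hε => h1 ε hε)
  linarith

/-! ### Rigidity -/

theorem exists_nat_recurrence {A : Type*} [AddCommGroup A] (f : ℕ → A → A) (a₀ a₁ : A) :
    ∃ a : ℕ → A, a 0 = a₀ ∧ a 1 = a₁ ∧ ∀ j, a (j + 2) = f (j + 1) (a (j + 1)) - a j := by
  let b : ℕ → A × A := fun k => Nat.rec (a₀, a₁) (fun k p => (p.2, f (k + 1) p.2 - p.1)) k
  exact ⟨fun j => (b j).1, rfl, rfl, fun _ => rfl⟩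

/-- If no extremal has conjugate points, the index form is nonnegative on every segment of every
extremal. -/
theorem indexForm_nonneg_of_no_conjugate {V : ℤ → E d → ℝ} (hV : ∀ n, ContDiff ℝ 2 (V n))
    (hper : ∀ n, IsLatticePeriodic (V n))
    (hconj : ∀ q, IsExtremal (frenkelKontorova V) q →
      ¬ HasConjugatePoints (frenkelKontorova V) q)
    (m : ℤ) (n : ℕ) (x : E d × E d) (ξ : ℕ → E d) (h0 : ξ 0 = 0) (hn : ξ (n + 1) = 0) :
    0 ≤ indexForm (orbitHess (fun j : ℕ => V (m + j)) x) n ξ ξ := by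
  refine indexForm_nonneg (fun j => hV _) (fun j => hper _) n ?_ x ξ h0 hn
  clear! x ξ
  intro x ξ h0 hn hrec
  set U : ℕ → E d → ℝ := fun j => V (m + j) with hU
  have hUV : ∀ j : ℕ, V (m + j + 1) = U (j + 1) := fun j => by
    simp only [hU, Nat.cast_add, Nat.cast_one, add_assoc]
  obtain ⟨q, hq, hqrec⟩ := exists_recurrence_extension
    (fun n p => (2 : ℝ) • p + gradient (V n) p) m (orbit U x) fun j => by
      rw [hUV, orbit_succ_succ]
  obtain ⟨a, ha0, ha1, ha⟩ := exists_nat_recurrence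
    (fun j p => (2 : ℝ) • p + orbitHess U x j p) (ξ 0) (ξ 1)
  obtain ⟨y, hy, hyrec⟩ := exists_recurrence_extension
    (fun n p => (2 : ℝ) • p + hess (V n) (q n) p) m a fun j => by
      have h1 : q (m + j + 1) = orbit U x (j + 1) := by
        rw [← hq]
        push_cast
        rw [add_assoc]
      rw [ha, hUV, h1, orbitHess]
  have hξ : ∀ j ≤ n + 1, ξ j = a j := by
    intro j
    induction j using Nat.twoStepInduction with
    | zero => exact fun _ => ha0.symm
    | one => exact fun _ => ha1.symm
    | more j ih0 ih1 =>
      intro hj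
      rw [hrec j (by omega), ha, ih0 (by omega), ih1 (by omega)]
  by_contra! hne
  obtain ⟨j, hj, hjne⟩ := hne
  refine hconj q ((isExtremal_iff hV q).2 hqrec) ⟨m, m + (n + 1 : ℕ), by omega, y,
    (isJacobiField_iff hV q y).2 hyrec, ⟨m + j, ?_⟩, ?_, ?_⟩
  · rwa [hy, ← hξ j hj]
  · rw [← add_zero m, ← Nat.cast_zero, hy, ← hξ 0 (by omega), h0]
  · rw [hy, ← hξ _ le_rfl, hn]

/-- The index form of the test fields, averaged over the torus of all orbits, is nonnegative only if
the mean square of `hess (V k) · e` vanishes for each basis vector `e`. -/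
theorem hess_eq_zero_of_no_conjugate {V : ℤ → E d → ℝ} (hV : ∀ n, ContDiff ℝ 2 (V n))
    (hper : ∀ n, IsLatticePeriodic (V n))
    (hconj : ∀ q, IsExtremal (frenkelKontorova V) q →
      ¬ HasConjugatePoints (frenkelKontorova V) q)
    (k : ℤ) (i : Fin d) (q : E d) : hess (V k) q (stdBasis d i) = 0 := by
  set e := stdBasis d i with he
  set c := volume.real (unitCube d) with hc
  have hcpos : 0 < c := ENNReal.toReal_pos
    (ZSpan.measure_fundamentalDomain_ne_zero (stdBasis d))
    (isBounded_unitCube d).measure_lt_top.ne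
  have hhess : ∀ n, Continuous fun q => hess (V n) q e := fun n =>
    (continuous_hess (hV n)).clm_apply continuous_const
  set F : E d → ℝ := fun q => ‖hess (V k) q e‖ ^ 2 with hF
  set G : E d → ℝ := fun q =>
    2 * ‖hess (V k) q e‖ ^ 2 + ⟪hess (V k) q (hess (V k) q e), hess (V k) q e⟫ with hG
  have hFc : Continuous F := (hhess k).norm.pow 2
  have hGc : Continuous G := (continuous_const.mul hFc).add
    (((continuous_hess (hV k)).clm_apply (hhess k)).inner (hhess k))
  have hFper : IsLatticePeriodic F := fun v q => by
    simp only [hF, hess_add_latticeVector (hper k)]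
  have hGper : IsLatticePeriodic G := fun v q => by
    simp only [hG, hess_add_latticeVector (hper k)]
  have key : ∀ M : ℕ, 0 < M → ∀ ε : ℝ, 0 < ε →
      0 ≤ (c * c * ‖e‖ ^ 2 * 4) / M - 2 * ε * (c * ∫ q in unitCube d, F q)
        + ε ^ 2 * (c * ∫ q in unitCube d, G q) := by
    intro M hM ε _
    -- the segment is placed so that its middle time `M + 1` is the time `k`
    set m : ℤ := k - (M + 1 : ℕ) with hm
    set U : ℕ → E d → ℝ := fun j => V (m + j) with hU
    have hUC : ∀ j, ContDiff ℝ 2 (U j) := fun j => hV _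
    have hUper : ∀ j, IsLatticePeriodic (U j) := fun j => hper _
    have hUM : U (M + 1) = V k := by simp [hU, hm]
    have hWs : ∀ x j u v, ⟪orbitHess U x j u, v⟫ = ⟪orbitHess U x j v, u⟫ := fun x j u v =>
      inner_hess_comm (hUC j) _ u v
    set A : ℝ := ‖e‖ ^ 2 *
      ∑ j ∈ Finset.range (2 * M + 2), (cutoff M (j + 1) - cutoff M j) ^ 2 with hA
    set H : ℕ → E d → ℝ := fun j p => ⟪hess (U j) p e, e⟫ with hH
    have hHc : ∀ j, Continuous (H j) := fun j => (hhess _).inner continuous_const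
    have hHper : ∀ j, IsLatticePeriodic (H j) := fun j v q => by
      simp only [hH, hess_add_latticeVector (hUper j)]
    have hpt : ∀ x : E d × E d, 0 ≤ A
        + ∑ j ∈ Finset.range (2 * M + 2), cutoff M j ^ 2 * H j (orbit U x j)
        - 2 * ε * F (orbit U x (M + 1)) + ε ^ 2 * G (orbit U x (M + 1)) := by
      intro x
      have hpos := indexForm_nonneg_of_no_conjugate hV hper hconj m (2 * M + 1) x
        (testField M e (orbitHess U x (M + 1) e) ε) (testField_zero _ _ _ _)
        (testField_last _ _ _ _)
      rw [indexForm_testField (orbitHess U x) (hWs x) hM e ε] at hpos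
      simpa only [orbitHess, hUM] using hpos
    have hi : ∀ (j : ℕ) {g : E d → ℝ}, Continuous g →
        Integrable (fun x => g (orbit U x j)) (torusMeasure d) := fun j g hg =>
      integrable_torusMeasure (hg.comp (continuous_orbit hUC j))
    have hint : 0 ≤ ∫ x, (A + ∑ j ∈ Finset.range (2 * M + 2), cutoff M j ^ 2 * H j (orbit U x j)
        - 2 * ε * F (orbit U x (M + 1)) + ε ^ 2 * G (orbit U x (M + 1))) ∂torusMeasure d :=
      integral_nonneg hpt
    have hsum : Integrable (fun x => ∑ j ∈ Finset.range (2 * M + 2),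
        cutoff M j ^ 2 * H j (orbit U x j)) (torusMeasure d) :=
      integrable_finsetSum _ fun j _ => (hi j (hHc j)).const_mul _
    have hsumA : Integrable (fun x => A + ∑ j ∈ Finset.range (2 * M + 2),
        cutoff M j ^ 2 * H j (orbit U x j)) (torusMeasure d) := (integrable_const A).add hsum
    have hsub : Integrable (fun x => A + ∑ j ∈ Finset.range (2 * M + 2),
        cutoff M j ^ 2 * H j (orbit U x j) - 2 * ε * F (orbit U x (M + 1))) (torusMeasure d) :=
      hsumA.sub ((hi _ hFc).const_mul _)
    rw [integral_add hsub ((hi _ hGc).const_mul _), integral_sub hsumA ((hi _ hFc).const_mul _),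
      integral_add (integrable_const A) hsum,
      integral_finsetSum _ fun j _ => (hi j (hHc j)).const_mul _] at hint
    simp only [integral_const_mul, integral_const, integral_orbit hUC hUper _ hFc hFper,
      integral_orbit hUC hUper _ hGc hGper, integral_orbit hUC hUper _ (hHc _) (hHper _)] at hint
    have hH0 : ∀ j, ∫ q in unitCube d, H j q = 0 := fun j =>
      integral_hess_stdBasis (hUC j) (hUper j) i
    have hvol : (torusMeasure d).real Set.univ = c * c := by
      rw [← Set.univ_prod_univ, measureReal_prod_prod]
      simp [hc]
    simp only [hH0, mul_zero, Finset.sum_const_zero, add_zero, hvol, smul_eq_mul] at hint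
    have hAle : c * c * A ≤ (c * c * ‖e‖ ^ 2 * 4) / M := by
      rw [mul_div_assoc, hA, mul_assoc (c * c)]
      gcongr
      exact sum_sq_cutoff_diff_le hM
    linarith
  have h1 := nonpos_of_forall_le key
  have h2 : ∫ q in unitCube d, F q ≤ 0 := by
    by_contra! h
    linarith [mul_pos hcpos h]
  have h3 := eq_zero_of_integral_nonpos hFc hFper (fun q => sq_nonneg _) h2 q
  simpa [hF] using h3

end DiscreteVariational

theorem theorem3 (d : ℕ) (V : ℤ → DiscreteVariational.E d → ℝ)
    (hsmooth : ∀ n : ℤ, ContDiff ℝ 2 (V n))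
    (hper : ∀ n : ℤ, DiscreteVariational.IsLatticePeriodic (V n))
    (hV : (∃ p : ℤ, 0 < p ∧ Function.Periodic V p) ∨
      {n : ℤ | ¬ DiscreteVariational.IsConstant (V n)}.Finite) :
    (∃ q : ℤ → DiscreteVariational.E d,
      DiscreteVariational.IsExtremal (DiscreteVariational.frenkelKontorova V) q ∧
      DiscreteVariational.HasConjugatePoints (DiscreteVariational.frenkelKontorova V) q) ∨
    (∀ n : ℤ, DiscreteVariational.IsConstant (V n)) := by
  refine or_iff_not_imp_left.2 fun h n => ?_
  push Not at h
  refine DiscreteVariational.isConstant_of_hess_eq_zero (hsmooth n) (hper n) fun q => ?_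
  refine ContinuousLinearMap.coe_injective ((DiscreteVariational.stdBasis d).ext fun i => ?_)
  exact DiscreteVariational.hess_eq_zero_of_no_conjugate hsmooth hper h n i q
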